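/- Let $G$ be a Hausdorff topological group. A subset $X \subseteq G$ is called precompact if for every open neighborhood $U$ of the identity there is a finite set $S \subseteq X$ such that $X \subseteq (SU) \cap (US)$, and $G$ is called locally precompact if some non-empty open subset of $G$ is precompact. A topological space has countable pseudocharacter if each of its singletons is a $G_\delta$-set (an intersection of countably many open sets), and it is homogeneous if for any two points $x, y$ there is a homeomorphism of the space onto itself that maps $x$ to $y$. Theorem. Let $G$ be a locally precompact Hausdorff topological group. Then $G$ has countable pseudocharacter if and only if there is a homogeneous metrizable topology on the set $G$ that is coarser than (or equal to) the given topology. Moreover, if $G$ has countable pseudocharacter, then there is a metric $d$ on $G$ that is left invariant, that is, $d(gx, gy) = d(x, y)$ for all $g, x, y \in G$, and whose topology is homogeneous and coarser than (or equal to) the given topology. -/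

import Mathlib

open scoped Topology Pointwise

/-- A subset `X` of a topological group is precompact if for every neighborhood `U` of the
identity there is a finite `S ⊆ X` with `X ⊆ SU ∩ US`. -/
def IsPrecompactSet {G : Type*} [Group G] [TopologicalSpace G] (X : Set G) : Prop :=
  ∀ U : Set G, IsOpen U → (1 : G) ∈ U → ∃ S : Set G, S.Finite ∧ S ⊆ X ∧ X ⊆ (S * U) ∩ (U * S)

/-- A topological group is locally precompact if some non-empty open subset is precompact. -/
def IsLocallyPrecompact (G : Type*) [Group G] [TopologicalSpace G] : Prop :=
  ∃ V : Set G, IsOpen V ∧ V.Nonempty ∧ IsPrecompactSet V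

/-- A space has countable pseudocharacter if every singleton is a `Gδ`-set. -/
def HasCountablePseudocharacter (X : Type*) [TopologicalSpace X] : Prop :=
  ∀ x : X, IsGδ ({x} : Set X)

/-- A space is homogeneous if its self-homeomorphisms act transitively on its points. -/
def IsHomogeneousSpace (X : Type*) [TopologicalSpace X] : Prop :=
  ∀ x y : X, ∃ f : X ≃ₜ X, f x = y

/-!
# Coarser left-invariant metrics on groups of countable pseudocharacter

If a metrizable topology is coarser than the given one, its singletons are `Gδ`-sets, being closed
in a metrizable space, and they remain `Gδ`-sets in the finer topology.

Conversely, let `{1} = ⋂ n, O n` with all `O n` open. The Birkhoff–Kakutani construction is applied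
to symmetric neighborhoods `U n` of `1` with `U (n + 1) ^ 3 ⊆ U n ∩ O n`
(`exists_seq_nhds_one_mul_subset`), whose intersection is `{1}`. They need not form a basis of the
neighborhoods of `1`, so the resulting metric only induces a coarser topology. The metric is the
largest pseudometric below the gauge `d x y = 2⁻ⁿ`, where `n` is the least index with
`x⁻¹ * y ∉ U n`. By `PseudoMetricSpace.le_two_mul_dist_ofPreNNDist` it satisfies `d ≤ 2 * dist`, so
it separates points, and it inherits left invariance from the gauge
(`dist_ofPreNNDist_mul_left`). Left translations are then isometries acting transitively, which
gives homogeneity (`isHomogeneousSpace_of_dist_mul_left`).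
-/

/-- Enlarging a topology preserves `Gδ`-sets, and in a metrizable space singletons are closed, hence
`Gδ`. -/
theorem hasCountablePseudocharacter_of_le_metrizable {X : Type*} {τ t : TopologicalSpace X}
    (hτ : τ ≤ t) (ht : @TopologicalSpace.MetrizableSpace X t) :
    @HasCountablePseudocharacter X τ := by
  intro x
  have hx : @IsGδ X t {x} := by
    let := TopologicalSpace.metrizableSpaceMetric X
    exact isClosed_singleton.isGδ
  obtain ⟨T, hT, hTc, hxT⟩ := hx
  exact ⟨T, fun s hs ↦ hτ s (hT s hs), hTc, hxT⟩

/-- The topology of a left-invariant metric on a group is homogeneous, because left translations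
are homeomorphisms acting transitively. -/
theorem isHomogeneousSpace_of_dist_mul_left {G : Type*} [Group G] [MetricSpace G]
    (h : ∀ g x y : G, dist (g * x) (g * y) = dist x y) : IsHomogeneousSpace G := by
  intro x y
  have hiso : Isometry (Equiv.mulLeft (y * x⁻¹)) := Isometry.of_dist_eq fun a b ↦ h _ a b
  exact ⟨(IsometryEquiv.mk _ hiso).toHomeomorph, inv_mul_cancel_right y x⟩

/-- The sequence that the Birkhoff–Kakutani construction needs: rapidly shrinking symmetric
neighborhoods of the identity, refining a given sequence of neighborhoods. -/
theorem exists_seq_nhds_one_mul_subset {G : Type*} [Group G] [TopologicalSpace G]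
    [IsTopologicalGroup G] (O : ℕ → Set G) (hO : ∀ n, O n ∈ 𝓝 1) :
    ∃ U : ℕ → Set G, (∀ n, U n ∈ 𝓝 1) ∧ (∀ n, (U n)⁻¹ = U n) ∧
      ∀ n, U (n + 1) * U (n + 1) * U (n + 1) ⊆ U n ∩ O n := by
  have step : ∀ s ∈ 𝓝 (1 : G), ∃ V ∈ 𝓝 (1 : G), V⁻¹ = V ∧ V * V * V ⊆ s := by
    intro s hs
    obtain ⟨V, hV, -, hVinv, hVs⟩ := exists_closed_nhds_one_inv_eq_mul_subset hs
    obtain ⟨W, hW, -, hWinv, hWV⟩ := exists_closed_nhds_one_inv_eq_mul_subset hV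
    have hW1 : W ⊆ V := (Set.subset_mul_left W (mem_of_mem_nhds hW)).trans hWV
    exact ⟨W, hW, hWinv, (Set.mul_subset_mul hWV hW1).trans hVs⟩
  choose! V hV hVinv hVs using step
  let U : ℕ → Set G := fun n ↦ Nat.rec Set.univ (fun n s ↦ V (s ∩ O n)) n
  have hU : ∀ n, U n ∈ 𝓝 1 := by
    intro n
    induction n with
    | zero => exact Filter.univ_mem
    | succ n ih => exact hV _ (Filter.inter_mem ih (hO n))
  refine ⟨U, hU, fun n ↦ ?_, fun n ↦ hVs _ (Filter.inter_mem (hU n) (hO n))⟩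
  cases n with
  | zero => exact Set.inv_univ
  | succ n => exact hVinv _ (Filter.inter_mem (hU n) (hO n))

/-- Left translation permutes the chains over which the infimum defining the pseudometric is
taken, and preserves their total `d`-length. -/
theorem dist_ofPreNNDist_mul_left {G : Type*} [Group G] (d : G → G → NNReal)
    (dist_self : ∀ x, d x x = 0) (dist_comm : ∀ x y, d x y = d y x)
    (hd : ∀ g x y, d (g * x) (g * y) = d x y) (g x y : G) :
    (PseudoMetricSpace.ofPreNNDist d dist_self dist_comm).dist (g * x) (g * y) =
      (PseudoMetricSpace.ofPreNNDist d dist_self dist_comm).dist x y := by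
  refine NNReal.coe_inj.2 (Eq.symm ?_)
  refine (List.map_surjective_iff.2 (mul_left_surjective g)).iInf_congr _ fun l ↦ ?_
  have h : l.map (g * ·) ++ [g * y] = (l ++ [y]).map (g * ·) := by simp
  rw [h, ← List.map_cons (f := (g * ·)), List.zipWith_map]
  simp only [hd]

/-- A topological group whose identity is a `Gδ`-point carries a left-invariant metric inducing a
coarser topology. -/
theorem exists_metricSpace_dist_mul_left {G : Type*} [Group G] [τ : TopologicalSpace G]
    [IsTopologicalGroup G] (h1 : IsGδ ({1} : Set G)) :
    ∃ m : MetricSpace G, τ ≤ m.toUniformSpace.toTopologicalSpace ∧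
      ∀ g x y : G, m.dist (g * x) (g * y) = m.dist x y := by
  classical
  obtain ⟨O, hOo, hO⟩ := isGδ_iff_eq_iInter_nat.1 h1
  have hO1 : ∀ n, O n ∈ 𝓝 (1 : G) := fun n ↦
    (hOo n).mem_nhds (Set.mem_iInter.1 (hO ▸ Set.mem_singleton (1 : G)) n)
  obtain ⟨U, hU, hUinv, hUO⟩ := exists_seq_nhds_one_mul_subset O hO1
  have hU1 : ∀ n, (1 : G) ∈ U n := fun n ↦ mem_of_mem_nhds (hU n)
  have hsub : ∀ n, U (n + 1) ⊆ U n ∩ O n := fun n x hx ↦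
    hUO n ⟨1 * 1, Set.mul_mem_mul (hU1 _) (hU1 _), x, hx, by simp⟩
  have hanti : Antitone U := antitone_nat_of_succ_le fun n ↦ (hsub n).trans Set.inter_subset_left
  have hsep : ∀ x, (∀ n, x ∈ U n) → x = 1 := fun x hx ↦ by
    have : x ∈ ({1} : Set G) := hO ▸ Set.mem_iInter.2 fun n ↦ (hsub n (hx (n + 1))).2
    exact this
  -- The gauge `f`; the value `0` is taken at the identity only.
  let f : G → NNReal := fun x ↦ if h : ∃ n, x ∉ U n then (1 / 2) ^ Nat.find h else 0
  have hr0 : (0 : NNReal) < 1 / 2 := half_pos one_pos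
  have hr1 : (1 / 2 : NNReal) < 1 := NNReal.half_lt_self one_ne_zero
  have hf1 : f 1 = 0 := dif_neg fun ⟨n, hn⟩ ↦ hn (hU1 n)
  have hf0 : ∀ x, f x = 0 → x = 1 := by
    intro x hx
    refine hsep x fun n ↦ by_contra fun hn ↦ ?_
    have h : ∃ n, x ∉ U n := ⟨n, hn⟩
    exact (pow_pos hr0 (Nat.find h)).ne' ((dif_pos h).symm.trans hx)
  have hfinv : ∀ x, f x⁻¹ = f x := by
    intro x
    have : ∀ n, x⁻¹ ∈ U n ↔ x ∈ U n := fun n ↦ by rw [← Set.mem_inv, hUinv]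
    simp only [f, this]
  have hfU : ∀ {x n}, (1 / 2) ^ n ≤ f x ↔ x ∉ U n := by
    intro x n
    dsimp only [f]
    split_ifs with h
    · rw [(pow_right_strictAnti₀ hr0 hr1).le_iff_ge, Nat.find_le_iff]
      exact ⟨fun ⟨m, hmn, hm⟩ hn ↦ hm (hanti hmn hn), fun h ↦ ⟨n, le_rfl, h⟩⟩
    · push Not at h
      simp only [h, not_true, (pow_pos hr0 _).not_ge]
  let d : G → G → NNReal := fun x y ↦ f (x⁻¹ * y)
  have d_self : ∀ x, d x x = 0 := fun x ↦ by simp only [d, inv_mul_cancel, hf1]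
  have d_comm : ∀ x y, d x y = d y x := fun x y ↦ by
    simp only [d]
    rw [← hfinv, mul_inv_rev, inv_inv]
  let I := PseudoMetricSpace.ofPreNNDist d d_self d_comm
  have hle : ∀ x y, I.dist x y ≤ d x y := PseudoMetricSpace.dist_ofPreNNDist_le d d_self d_comm
  have hge : ∀ x y, d x y ≤ 2 * I.dist x y := by
    refine PseudoMetricSpace.le_two_mul_dist_ofPreNNDist d d_self d_comm fun x₁ x₂ x₃ x₄ ↦ ?_
    by_cases H : ∃ n, x₁⁻¹ * x₄ ∉ U n
    · refine (dif_pos H).trans_le ?_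
      -- If the three shorter steps lie in `U (n + 1)`, the product of them lies in `U n`.
      rw [← div_le_iff₀' zero_lt_two, ← mul_one_div (_ ^ _), ← pow_succ]
      simp only [le_max_iff, d, hfU, ← not_and_or]
      rintro ⟨h₁₂, h₂₃, h₃₄⟩
      refine Nat.find_spec H (hUO _ ?_).1
      exact ⟨_, Set.mul_mem_mul h₁₂ h₂₃, _, h₃₄, by group⟩
    · exact (dif_neg H).trans_le zero_le
  refine ⟨{ I with eq_of_dist_eq_zero := fun {x y} hxy ↦ ?_ }, ?_,
    dist_ofPreNNDist_mul_left d d_self d_comm fun g x y ↦ ?_⟩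
  · have h := hge x y
    have hxy' : I.dist x y = 0 := hxy
    rw [hxy', mul_zero] at h
    exact inv_mul_eq_one.1 (hf0 _ (NNReal.coe_eq_zero.1 (le_antisymm h (NNReal.coe_nonneg _))))
  · refine le_of_nhds_le_nhds fun x ↦ ?_
    refine (@Metric.nhds_basis_ball G I x).ge_iff.2 fun ε hε ↦ ?_
    obtain ⟨n, hn⟩ := exists_pow_lt_of_lt_one hε (show (1 / 2 : ℝ) < 1 by norm_num)
    -- The translate `x * U n` is contained in the ball of radius `ε` around `x`.
    have hx : (fun y ↦ x⁻¹ * y) ⁻¹' U n ∈ 𝓝 x :=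
      (continuous_const_mul x⁻¹).continuousAt.preimage_mem_nhds (by simpa using hU n)
    filter_upwards [hx] with y hy
    have hlt : d x y < (1 / 2) ^ n := lt_of_not_ge fun h ↦ hfU.1 h hy
    have hlt' : (d x y : ℝ) < (1 / 2) ^ n := by exact_mod_cast hlt
    have := (hle x y).trans_lt (hlt'.trans hn)
    rwa [Metric.mem_ball']
  · simp only [d]
    congr 1
    group

/-- In the order on `TopologicalSpace G`, `τ ≤ t` says that `t` is coarser than `τ`. -/
theorem theorem3 {G : Type*} [Group G] [τ : TopologicalSpace G] [IsTopologicalGroup G]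
    [T2Space G] (hG : IsLocallyPrecompact G) :
    (HasCountablePseudocharacter G ↔
      ∃ t : TopologicalSpace G, τ ≤ t ∧ @IsHomogeneousSpace G t ∧
        @TopologicalSpace.MetrizableSpace G t) ∧
    (HasCountablePseudocharacter G →
      ∃ m : MetricSpace G, τ ≤ m.toUniformSpace.toTopologicalSpace ∧
        @IsHomogeneousSpace G m.toUniformSpace.toTopologicalSpace ∧
        ∀ g x y : G, m.dist (g * x) (g * y) = m.dist x y) := by
  have key (h : HasCountablePseudocharacter G) :
      ∃ m : MetricSpace G, τ ≤ m.toUniformSpace.toTopologicalSpace ∧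
        @IsHomogeneousSpace G m.toUniformSpace.toTopologicalSpace ∧
        ∀ g x y : G, m.dist (g * x) (g * y) = m.dist x y := by
    obtain ⟨m, hm, hinv⟩ := exists_metricSpace_dist_mul_left (h 1)
    exact ⟨m, hm, @isHomogeneousSpace_of_dist_mul_left G _ m hinv, hinv⟩
  refine ⟨⟨fun h ↦ ?_, fun ⟨t, hτt, _, ht⟩ ↦ hasCountablePseudocharacter_of_le_metrizable hτt ht⟩,
    key⟩
  obtain ⟨m, hm, hhom, -⟩ := key h
  exact ⟨m.toUniformSpace.toTopologicalSpace, hm, hhom,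
    @UniformSpace.metrizableSpace G m.toUniformSpace inferInstance inferInstance⟩
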